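/- All functions are real valued; $L^2(\mathbb{R})$ is the real $L^2$ space with respect to Lebesgue measure, $(f,g)=\int_{\mathbb{R}} fg\,dx$, and $\widehat v$ denotes the Plancherel transform of $v\in L^2(\mathbb{R})$, which extends $\widehat v(\xi)=\int_{\mathbb{R}} e^{-2\pi i x\xi}v(x)\,dx$. For $\mu\ge 0$ let $n=\lfloor\mu\rfloor+1$ be the smallest integer greater than $\mu$, and for $\psi\in C_0^\infty(\mathbb{R})$ put $$\boldsymbol{D}^{\mu}\psi(x)=\frac{d^n}{dx^n}\,\frac{1}{\Gamma(n-\mu)}\int_{-\infty}^x (x-t)^{n-\mu-1}\psi(t)\,dt,\qquad \boldsymbol{D}^{\mu*}\psi(x)=(-1)^n\frac{d^n}{dx^n}\,\frac{1}{\Gamma(n-\mu)}\int_x^{\infty} (t-x)^{n-\mu-1}\psi(t)\,dt$$ (so $\boldsymbol{D}^{0}\psi=\boldsymbol{D}^{0*}\psi=\psi$). For $s\ge 0$ and $v,w\in L^1_{loc}(\mathbb{R})$, $w$ is the weak left (respectively right) derivative of order $s$ of $v$, written $w=\boldsymbol{D}^sv$ (respectively $w=\boldsymbol{D}^{s*}v$),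 if for all $\psi\in C_0^\infty(\mathbb{R})$ the product $v\,\boldsymbol{D}^{s*}\psi$ (respectively $v\,\boldsymbol{D}^{s}\psi$) is integrable and $(v,\boldsymbol{D}^{s*}\psi)=(w,\psi)$ (respectively $(v,\boldsymbol{D}^{s}\psi)=(w,\psi)$); such a $w$ is unique almost everywhere. Let $$\widetilde W^s_L(\mathbb{R})=\{v\in L^2(\mathbb{R}):\boldsymbol{D}^sv\in L^2(\mathbb{R})\},\qquad \|v\|_L=\bigl(\|v\|_{L^2}^2+\|\boldsymbol{D}^sv\|_{L^2}^2\bigr)^{1/2},$$ $$\widetilde W^s_R(\mathbb{R})=\{v\in L^2(\mathbb{R}):\boldsymbol{D}^{s*}v\in L^2(\mathbb{R})\},\qquad \|v\|_R=\bigl(\|v\|_{L^2}^2+\|\boldsymbol{D}^{s*}v\|_{L^2}^2\bigr)^{1/2},$$ $$\widehat H^s(\mathbb{R})=\Bigl\{v\in L^2(\mathbb{R}):\int_{\mathbb{R}}(1+|2\pi\xi|^{2s})|\widehat v(\xi)|^2\,d\xi<\infty\Bigr\},\qquad \|v\|_{\widehat H^s}=\bigl(\|v\|_{L^2}^2+\||2\pi\xi|^s\,\widehat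 v\|_{L^2}^2\bigr)^{1/2}.$$ **Theorem.** For every real $s\ge 0$, $\widetilde W^s_L(\mathbb{R})=\widetilde W^s_R(\mathbb{R})=\widehat H^s(\mathbb{R})$ as linear subspaces of $L^2(\mathbb{R})$, and $\|v\|_L=\|v\|_R=\|v\|_{\widehat H^s}$ for every $v$ in this common space. Moreover, for every such $v$ and almost every $\xi\in\mathbb{R}$, $$\widehat{\boldsymbol{D}^sv}(\xi)=(2\pi i\xi)^s\,\widehat v(\xi),\qquad \widehat{\boldsymbol{D}^{s*}v}(\xi)=(-2\pi i\xi)^s\,\widehat v(\xi),$$ where $(\pm i\eta)^s:=|\eta|^s e^{\pm s\pi i\,\mathrm{sign}(\eta)/2}$ for real $\eta$. -/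

import Mathlib

open MeasureTheory Set
open scoped ContDiff FourierTransform

noncomputable section

namespace FracSobolev

/-- The real Hilbert space `L²(ℝ)` of real-valued functions. -/
abbrev L2 : Type := Lp ℝ 2 (volume : Measure ℝ)

/-- The space `C₀^∞(ℝ)` of real-valued test functions. -/
def IsTestFunction (ψ : ℝ → ℝ) : Prop := ContDiff ℝ ∞ ψ ∧ HasCompactSupport ψ

/-- Left Riemann–Liouville fractional integral of order `σ > 0` with base point `-∞`. -/
def leftRLIntegral (σ : ℝ) (w : ℝ → ℝ) (x : ℝ) : ℝ :=
  1 / Real.Gamma σ * ∫ t in Iio x, (x - t) ^ (σ - 1) * w t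

/-- Right Riemann–Liouville fractional integral of order `σ > 0` with base point `∞`. -/
def rightRLIntegral (σ : ℝ) (w : ℝ → ℝ) (x : ℝ) : ℝ :=
  1 / Real.Gamma σ * ∫ t in Ioi x, (t - x) ^ (σ - 1) * w t

/-- Left Riemann–Liouville derivative of order `μ ≥ 0`: with `n = ⌊μ⌋ + 1` the smallest integer
greater than `μ`, the `n`-th derivative of the left integral of order `n - μ`.
For `μ = 0` this is the derivative of `x ↦ ∫_{-∞}^x w`, i.e. the identity on test functions. -/
def leftRLDeriv (μ : ℝ) (w : ℝ → ℝ) : ℝ → ℝ :=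
  iteratedDeriv (⌊μ⌋₊ + 1) (leftRLIntegral (((⌊μ⌋₊ + 1 : ℕ) : ℝ) - μ) w)

/-- Right Riemann–Liouville derivative of order `μ ≥ 0`. -/
def rightRLDeriv (μ : ℝ) (w : ℝ → ℝ) (x : ℝ) : ℝ :=
  (-1) ^ (⌊μ⌋₊ + 1) *
    iteratedDeriv (⌊μ⌋₊ + 1) (rightRLIntegral (((⌊μ⌋₊ + 1 : ℕ) : ℝ) - μ) w) x

/-- `w` is a weak left fractional derivative of order `s` of `v`. The integrability clause
says that the pairing of `v` with the derivative of the test function makes sense; it is automatic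
for `v ∈ L²(ℝ)`. -/
def IsWeakLeftDeriv (s : ℝ) (v w : ℝ → ℝ) : Prop :=
  LocallyIntegrable v ∧ LocallyIntegrable w ∧ ∀ ψ : ℝ → ℝ, IsTestFunction ψ →
    Integrable (fun x => v x * rightRLDeriv s ψ x) ∧
      ∫ x, v x * rightRLDeriv s ψ x = ∫ x, w x * ψ x

/-- `w` is a weak right fractional derivative of order `s` of `v`. -/
def IsWeakRightDeriv (s : ℝ) (v w : ℝ → ℝ) : Prop :=
  LocallyIntegrable v ∧ LocallyIntegrable w ∧ ∀ ψ : ℝ → ℝ, IsTestFunction ψ →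
    Integrable (fun x => v x * leftRLDeriv s ψ x) ∧
      ∫ x, v x * leftRLDeriv s ψ x = ∫ x, w x * ψ x

theorem L2.locallyIntegrable (v : L2) : LocallyIntegrable (v : ℝ → ℝ) :=
  (Lp.memLp v).locallyIntegrable (by norm_num)

theorem integrable_mul_test {w ψ : ℝ → ℝ} (hw : LocallyIntegrable w) (hψ : IsTestFunction ψ) :
    Integrable (fun x => w x * ψ x) := by
  simpa [mul_comm] using
    hw.integrable_smul_left_of_hasCompactSupport hψ.1.continuous hψ.2

theorem ae_eq_of_pairing {w₁ w₂ : ℝ → ℝ} (h₁ : LocallyIntegrable w₁) (h₂ : LocallyIntegrable w₂)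
    (h : ∀ ψ : ℝ → ℝ, IsTestFunction ψ → ∫ x, w₁ x * ψ x = ∫ x, w₂ x * ψ x) :
    w₁ =ᵐ[volume] w₂ := by
  refine ae_eq_of_integral_contDiff_smul_eq h₁ h₂ fun g hg hc => ?_
  simpa [mul_comm] using h g ⟨hg, hc⟩

theorem IsWeakLeftDeriv.unique {s : ℝ} {v w₁ w₂ : ℝ → ℝ} (h₁ : IsWeakLeftDeriv s v w₁)
    (h₂ : IsWeakLeftDeriv s v w₂) : w₁ =ᵐ[volume] w₂ :=
  ae_eq_of_pairing h₁.2.1 h₂.2.1 fun ψ hψ => (h₁.2.2 ψ hψ).2.symm.trans (h₂.2.2 ψ hψ).2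

theorem IsWeakRightDeriv.unique {s : ℝ} {v w₁ w₂ : ℝ → ℝ} (h₁ : IsWeakRightDeriv s v w₁)
    (h₂ : IsWeakRightDeriv s v w₂) : w₁ =ᵐ[volume] w₂ :=
  ae_eq_of_pairing h₁.2.1 h₂.2.1 fun ψ hψ => (h₁.2.2 ψ hψ).2.symm.trans (h₂.2.2 ψ hψ).2

/-- Auxiliary closure fact for sums: `D ψ` stands for either fractional derivative of `ψ`. -/
theorem pairing_add {D ψ : ℝ → ℝ} {v₁ v₂ w₁ w₂ : L2} (hψ : IsTestFunction ψ)
    (h₁ : Integrable (fun x => v₁ x * D x) ∧ ∫ x, v₁ x * D x = ∫ x, w₁ x * ψ x)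
    (h₂ : Integrable (fun x => v₂ x * D x) ∧ ∫ x, v₂ x * D x = ∫ x, w₂ x * ψ x) :
    Integrable (fun x => (v₁ + v₂ : L2) x * D x) ∧
      ∫ x, (v₁ + v₂ : L2) x * D x = ∫ x, (w₁ + w₂ : L2) x * ψ x := by
  have hv : (fun x => (v₁ + v₂ : L2) x * D x) =ᵐ[volume] fun x => v₁ x * D x + v₂ x * D x := by
    filter_upwards [Lp.coeFn_add v₁ v₂] with x hx
    rw [hx, Pi.add_apply, add_mul]
  have hw : (fun x => (w₁ + w₂ : L2) x * ψ x) =ᵐ[volume] fun x => w₁ x * ψ x + w₂ x * ψ x := by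
    filter_upwards [Lp.coeFn_add w₁ w₂] with x hx
    rw [hx, Pi.add_apply, add_mul]
  refine ⟨(h₁.1.add h₂.1).congr hv.symm, ?_⟩
  rw [integral_congr_ae hv, integral_congr_ae hw, integral_add h₁.1 h₂.1,
    integral_add (integrable_mul_test w₁.locallyIntegrable hψ)
      (integrable_mul_test w₂.locallyIntegrable hψ), h₁.2, h₂.2]

theorem pairing_smul {D ψ : ℝ → ℝ} (c : ℝ) {v w : L2}
    (h : Integrable (fun x => v x * D x) ∧ ∫ x, v x * D x = ∫ x, w x * ψ x) :
    Integrable (fun x => (c • v : L2) x * D x) ∧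
      ∫ x, (c • v : L2) x * D x = ∫ x, (c • w : L2) x * ψ x := by
  have hv : (fun x => (c • v : L2) x * D x) =ᵐ[volume] fun x => c * (v x * D x) := by
    filter_upwards [Lp.coeFn_smul c v] with x hx
    rw [hx, Pi.smul_apply, smul_eq_mul, mul_assoc]
  have hw : (fun x => (c • w : L2) x * ψ x) =ᵐ[volume] fun x => c * (w x * ψ x) := by
    filter_upwards [Lp.coeFn_smul c w] with x hx
    rw [hx, Pi.smul_apply, smul_eq_mul, mul_assoc]
  refine ⟨(h.1.const_mul c).congr hv.symm, ?_⟩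
  rw [integral_congr_ae hv, integral_congr_ae hw, integral_const_mul, integral_const_mul, h.2]

theorem pairing_zero {D ψ : ℝ → ℝ} :
    Integrable (fun x => (0 : L2) x * D x) ∧
      ∫ x, (0 : L2) x * D x = ∫ x, (0 : L2) x * ψ x := by
  have h : ∀ g : ℝ → ℝ, (fun x => (0 : L2) x * g x) =ᵐ[volume] fun _ => (0 : ℝ) := by
    intro g
    filter_upwards [Lp.coeFn_zero ℝ 2 (volume : Measure ℝ)] with x hx
    rw [hx, Pi.zero_apply, zero_mul]
  exact ⟨(integrable_zero _ _ _).congr (h D).symm, by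
    rw [integral_congr_ae (h D), integral_congr_ae (h ψ)]⟩

/-- The space of all `v ∈ L²(ℝ)` with a weak left derivative of order `s` in `L²(ℝ)`. -/
def WL (s : ℝ) : Submodule ℝ L2 where
  carrier := {v | ∃ w : L2, IsWeakLeftDeriv s v w}
  add_mem' := by
    rintro v₁ v₂ ⟨w₁, h₁⟩ ⟨w₂, h₂⟩
    exact ⟨w₁ + w₂, L2.locallyIntegrable _, L2.locallyIntegrable _, fun ψ hψ =>
      pairing_add hψ (h₁.2.2 ψ hψ) (h₂.2.2 ψ hψ)⟩
  zero_mem' := ⟨0, L2.locallyIntegrable _, L2.locallyIntegrable _, fun _ _ => pairing_zero⟩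
  smul_mem' := by
    rintro c v ⟨w, h⟩
    exact ⟨c • w, L2.locallyIntegrable _, L2.locallyIntegrable _, fun ψ hψ =>
      pairing_smul c (h.2.2 ψ hψ)⟩

/-- The space of all `v ∈ L²(ℝ)` with a weak right derivative of order `s` in `L²(ℝ)`. -/
def WR (s : ℝ) : Submodule ℝ L2 where
  carrier := {v | ∃ w : L2, IsWeakRightDeriv s v w}
  add_mem' := by
    rintro v₁ v₂ ⟨w₁, h₁⟩ ⟨w₂, h₂⟩
    exact ⟨w₁ + w₂, L2.locallyIntegrable _, L2.locallyIntegrable _, fun ψ hψ =>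
      pairing_add hψ (h₁.2.2 ψ hψ) (h₂.2.2 ψ hψ)⟩
  zero_mem' := ⟨0, L2.locallyIntegrable _, L2.locallyIntegrable _, fun _ _ => pairing_zero⟩
  smul_mem' := by
    rintro c v ⟨w, h⟩
    exact ⟨c • w, L2.locallyIntegrable _, L2.locallyIntegrable _, fun ψ hψ =>
      pairing_smul c (h.2.2 ψ hψ)⟩

/-- The weak left derivative of `v`, unique as an element of `L²(ℝ)`
by `IsWeakLeftDeriv.unique`. -/
def weakLeftDeriv {s : ℝ} (v : WL s) : L2 := Classical.choose v.2

theorem weakLeftDeriv_spec {s : ℝ} (v : WL s) :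
    IsWeakLeftDeriv s (v : L2) (weakLeftDeriv v) := Classical.choose_spec v.2

/-- The weak right derivative of `v`, unique as an element of `L²(ℝ)`
by `IsWeakRightDeriv.unique`. -/
def weakRightDeriv {s : ℝ} (v : WR s) : L2 := Classical.choose v.2

theorem weakRightDeriv_spec {s : ℝ} (v : WR s) :
    IsWeakRightDeriv s (v : L2) (weakRightDeriv v) := Classical.choose_spec v.2

def normWL {s : ℝ} (v : WL s) : ℝ := √(‖(v : L2)‖ ^ 2 + ‖weakLeftDeriv v‖ ^ 2)

def normWR {s : ℝ} (v : WR s) : ℝ := √(‖(v : L2)‖ ^ 2 + ‖weakRightDeriv v‖ ^ 2)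

/-- The inclusion of real-valued into complex-valued square integrable functions. -/
def toComplex (v : L2) : Lp ℂ 2 (volume : Measure ℝ) :=
  Complex.ofRealCLM.compLpL 2 (volume : Measure ℝ) v

/-- The Plancherel transform, extending `𝓕 v ξ = ∫ exp (-2πixξ) v x dx`. -/
def plancherel (v : L2) : Lp ℂ 2 (volume : Measure ℝ) := 𝓕 (toComplex v)

theorem plancherel_add (v w : L2) : plancherel (v + w) = plancherel v + plancherel w := by
  simp [plancherel, toComplex, FourierTransform.fourier_add]

theorem plancherel_smul (c : ℝ) (v : L2) : plancherel (c • v) = (c : ℂ) • plancherel v := by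
  have h : toComplex (c • v) = (c : ℂ) • toComplex v := by
    rw [toComplex, map_smul]
    ext1
    filter_upwards [Lp.coeFn_smul c (toComplex v), Lp.coeFn_smul (c : ℂ) (toComplex v)]
      with x h₁ h₂
    rw [h₂]
    exact h₁.trans (by simp)
  rw [plancherel, h, FourierTransform.fourier_smul, plancherel]

/-- The Sobolev space of order `s ≥ 0` defined by the Plancherel transform. -/
def HF (s : ℝ) : Submodule ℝ L2 where
  carrier := {v | Integrable fun ξ : ℝ =>
    (1 + |2 * Real.pi * ξ| ^ (2 * s)) * ‖plancherel v ξ‖ ^ 2}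
  add_mem' := by
    intro v w hv hw
    refine Integrable.mono' ((hv.add hw).const_mul 2) ?_ ?_
    · have h1 : Measurable fun ξ : ℝ => 1 + |2 * Real.pi * ξ| ^ (2 * s) := by fun_prop
      exact h1.aestronglyMeasurable.mul ((Lp.aestronglyMeasurable _).norm.pow 2)
    · rw [plancherel_add]
      filter_upwards [Lp.coeFn_add (plancherel v) (plancherel w)] with ξ hξ
      rw [hξ, Pi.add_apply]
      have h0 : 0 ≤ 1 + |2 * Real.pi * ξ| ^ (2 * s) := by positivity
      rw [Real.norm_of_nonneg (by positivity)]
      have h1 : ‖plancherel v ξ + plancherel w ξ‖ ^ 2 ≤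
          2 * (‖plancherel v ξ‖ ^ 2 + ‖plancherel w ξ‖ ^ 2) := by
        have := norm_add_le (plancherel v ξ) (plancherel w ξ)
        have := pow_le_pow_left₀ (norm_nonneg _) this 2
        nlinarith [sq_nonneg (‖plancherel v ξ‖ - ‖plancherel w ξ‖)]
      calc _ ≤ _ := mul_le_mul_of_nonneg_left h1 h0
        _ = _ := by simp only [Pi.add_apply]; ring
  zero_mem' := by
    have h : plancherel 0 = 0 := by simpa using plancherel_smul 0 0
    refine (integrable_zero ℝ ℝ volume).congr ?_
    rw [h]
    filter_upwards [Lp.coeFn_zero ℂ 2 (volume : Measure ℝ)] with ξ hξ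
    rw [hξ]
    simp
  smul_mem' := by
    intro c v hv
    refine (hv.const_mul (c ^ 2)).congr ?_
    rw [plancherel_smul]
    filter_upwards [Lp.coeFn_smul (c : ℂ) (plancherel v)] with ξ hξ
    rw [hξ, Pi.smul_apply, norm_smul, mul_pow, Complex.norm_real, Real.norm_eq_abs, sq_abs]
    ring

/-- The seminorm `‖(2πξ)^s v̂‖` in `L²(ℝ)`, which is finite for `v ∈ HF s`. -/
def seminormHF {s : ℝ} (v : HF s) : ℝ :=
  (eLpNorm (fun ξ : ℝ => |2 * Real.pi * ξ| ^ s * ‖plancherel (v : L2) ξ‖) 2 volume).toReal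

def normHF {s : ℝ} (v : HF s) : ℝ := √(‖(v : L2)‖ ^ 2 + seminormHF v ^ 2)

/-- The power `(iη)^s := |η|^s exp (sπi sign η / 2)` for real `η`. -/
def iPow (s η : ℝ) : ℂ :=
  ((|η| ^ s : ℝ) : ℂ) * Complex.exp (s * Real.pi * Complex.I * (SignType.sign η : ℝ) / 2)

end FracSobolev

end

/-!
On the Fourier side both fractional derivatives are multiplications, and everything rests on one
computation: for a test function `ψ` the left Riemann–Liouville derivative of order `s` is the
inverse Fourier integral of `(2πiξ)^s ψ̂`, and the right one that of `(-2πiξ)^s ψ̂`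
(`leftRLDeriv_eq_fourierInv`, `rightRLDeriv_eq_fourierInv`). The `n` derivatives are moved onto `ψ`
under the convolution with the power kernel, so that `n - s ∈ (0, 1]` is the order of the remaining
fractional integral. Its kernel is not integrable; it is damped by `exp (-εt)`, whereupon Fubini
and the Laplace transform of the power kernel (`integral_powKernel_mul_cexp`) yield the symbol
`(ε + 2πiξ)^(s-n)`, and `ε → 0` by dominated convergence on both sides. The right derivative
follows by reflection.

Since `(±2πiξ)^s ψ̂` lies in `L¹ ∩ L²`, Parseval's identity turns the defining relation of a weak
derivative `w` of `v` into `∫ conj ψ̂ · (m v̂ - ŵ) = 0` for all test functions `ψ`, where `m` is the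
conjugate symbol. Translating `ψ` modulates `ψ̂`, so the product `conj ψ̂ · (m v̂ - ŵ)` has a
vanishing inverse Fourier transform and is zero; narrow bumps have transforms without zeros on
large intervals, hence `ŵ = m v̂` (`ae_eq_zero_of_integral_realFourier`). Conversely, if
`m v̂ ∈ L²`, its inverse transform is a weak derivative; it is real because it pairs to real numbers
with real test functions (`IsAdjointMultiplier.exists_pairing`). As `|m| = |2πξ|^s`, the condition
`m v̂ ∈ L²` defines the Fourier Sobolev space, and Plancherel's theorem gives equality of the norms.
-/

namespace FracSobolev

open scoped ComplexConjugate SchwartzMap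
open Filter Topology

/-! ### The inverse Fourier integral on `L¹` and `L²` -/

theorem continuous_fourierInv {f : ℝ → ℂ} (hf : Integrable f) : Continuous (𝓕⁻ f) :=
  VectorFourier.fourierIntegral_continuous Real.continuous_fourierChar
    (by exact (innerSL ℝ).continuous₂.neg) hf

theorem integral_fourierInv_mul_eq {f g : ℝ → ℂ} (hf : Integrable f) (hg : Integrable g) :
    ∫ x, 𝓕⁻ f x * g x = ∫ x, f x * 𝓕⁻ g x := by
  have h := VectorFourier.integral_fourierIntegral_smul_eq_flip (μ := volume) (ν := volume)
    (L := -innerₗ ℝ) Real.continuous_fourierChar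
    (by exact (innerSL ℝ).continuous₂.neg) hf hg
  have hL : (-innerₗ ℝ : ℝ →ₗ[ℝ] ℝ →ₗ[ℝ] ℝ).flip = -innerₗ ℝ := by
    ext; simp
  rw [hL] at h
  exact h

/-- The `L²` inverse Fourier transform agrees with the inverse Fourier integral
on `L¹ ∩ L²`. -/
theorem fourierInv_toLp_ae_eq {f : ℝ → ℂ} (h1 : Integrable f) (h2 : MemLp f 2) :
    (𝓕⁻ (h2.toLp f) : Lp ℂ 2 (volume : Measure ℝ)) =ᵐ[volume] 𝓕⁻ f := by
  refine ae_eq_of_integral_contDiff_smul_eq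
    ((Lp.memLp _).locallyIntegrable (by norm_num))
    (continuous_fourierInv h1).locallyIntegrable fun g hg hc => ?_
  let S : 𝓢(ℝ, ℂ) := HasCompactSupport.toSchwartzMap (f := fun x => (g x : ℂ))
    (hc.comp_left (g := fun y : ℝ => (y : ℂ)) Complex.ofReal_zero)
    (Complex.ofRealCLM.contDiff.comp hg)
  have hS : ∀ x, S x = (g x : ℂ) := fun _ => rfl
  have hT := congrArg (fun T => T S) (Lp.fourierInv_toTemperedDistribution_eq (h2.toLp f))
  simp only [TemperedDistribution.fourierInv_apply, Lp.toTemperedDistribution_apply] at hT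
  calc ∫ x, g x • (𝓕⁻ (h2.toLp f) : Lp ℂ 2 (volume : Measure ℝ)) x
      = ∫ x, S x • (𝓕⁻ (h2.toLp f) : Lp ℂ 2 (volume : Measure ℝ)) x := by
        simp [hS]
    _ = ∫ x, 𝓕⁻ S x • h2.toLp f x := hT.symm
    _ = ∫ x, 𝓕⁻ (S : ℝ → ℂ) x * f x := by
        refine integral_congr_ae ?_
        filter_upwards [h2.coeFn_toLp] with x hx
        rw [hx, SchwartzMap.fourierInv_coe, smul_eq_mul]
    _ = ∫ x, S x * 𝓕⁻ f x := integral_fourierInv_mul_eq S.integrable h1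
    _ = ∫ x, g x • 𝓕⁻ f x := by simp [hS]

/-- A function in `L¹` whose inverse Fourier integral vanishes identically is zero. -/
theorem ae_eq_zero_of_fourierInv_eq_zero {f : ℝ → ℂ} (hf : Integrable f)
    (h : ∀ x, 𝓕⁻ f x = 0) : f =ᵐ[volume] 0 := by
  refine ae_eq_zero_of_integral_contDiff_smul_eq_zero hf.locallyIntegrable fun g hg hc => ?_
  let S : 𝓢(ℝ, ℂ) := HasCompactSupport.toSchwartzMap (f := fun x => (g x : ℂ))
    (hc.comp_left (g := fun y : ℝ => (y : ℂ)) Complex.ofReal_zero)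
    (Complex.ofRealCLM.contDiff.comp hg)
  have hS : 𝓕⁻ ((𝓕 S : 𝓢(ℝ, ℂ)) : ℝ → ℂ) = S := by
    rw [← SchwartzMap.fourierInv_coe, FourierTransform.fourierInv_fourier_eq]
  have := integral_fourierInv_mul_eq hf (𝓕 S : 𝓢(ℝ, ℂ)).integrable
  rw [hS] at this
  simp only [h, zero_mul, integral_zero] at this
  rw [this]
  refine integral_congr_ae (Eventually.of_forall fun x => ?_)
  change _ = f x * (g x : ℂ)
  simp [mul_comm]

/-- Parseval's identity for the pairing of `V ∈ L²` with a real-valued inverse Fourier integral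
`d`, which is itself square integrable because its symbol `h` lies in `L¹ ∩ L²`. -/
theorem integral_mul_eq_of_fourierInv {d : ℝ → ℝ} {h : ℝ → ℂ} (h1 : Integrable h)
    (h2 : MemLp h 2) (hd : ∀ x, (d x : ℂ) = 𝓕⁻ h x) (V : Lp ℂ 2 (volume : Measure ℝ)) :
    MemLp d 2 ∧ ∫ x, V x * d x = ∫ ξ, conj (h ξ) * (𝓕 V : Lp ℂ 2 (volume : Measure ℝ)) ξ := by
  have hae : (𝓕⁻ (h2.toLp h) : Lp ℂ 2 (volume : Measure ℝ)) =ᵐ[volume] fun x => (d x : ℂ) := by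
    filter_upwards [fourierInv_toLp_ae_eq h1 h2] with x hx
    rw [hx, hd]
  have hdC : MemLp (fun x => (d x : ℂ)) 2 := (memLp_congr_ae hae).1 (Lp.memLp _)
  refine ⟨by simpa using hdC.re, ?_⟩
  have hP := Lp.inner_fourier_eq (𝓕⁻ (h2.toLp h) : Lp ℂ 2 (volume : Measure ℝ)) V
  rw [FourierTransform.fourier_fourierInv_eq, L2.inner_def, L2.inner_def] at hP
  have e1 : ∫ x, V x * d x = ∫ x, inner ℂ
      ((𝓕⁻ (h2.toLp h) : Lp ℂ 2 (volume : Measure ℝ)) x) (V x) := by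
    refine integral_congr_ae ?_
    filter_upwards [hae] with x hx
    rw [hx]
    simp [RCLike.inner_apply, mul_comm]
  rw [e1, ← hP]
  refine integral_congr_ae ?_
  filter_upwards [h2.coeFn_toLp] with x hx
  rw [hx]
  simp [RCLike.inner_apply, mul_comm]

/-! ### The Fourier transform of test functions -/

/-- A test function as a complex-valued Schwartz function. -/
noncomputable def IsTestFunction.toSchwartz {ψ : ℝ → ℝ} (hψ : IsTestFunction ψ) : 𝓢(ℝ, ℂ) :=
  HasCompactSupport.toSchwartzMap (f := fun x => (ψ x : ℂ))
    (hψ.2.comp_left (g := fun y : ℝ => (y : ℂ)) Complex.ofReal_zero)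
    (Complex.ofRealCLM.contDiff.comp hψ.1)

/-- The Fourier integral of a real-valued function. -/
noncomputable def realFourier (ψ : ℝ → ℝ) : ℝ → ℂ := 𝓕 fun x => (ψ x : ℂ)

theorem IsTestFunction.coe_toSchwartz {ψ : ℝ → ℝ} (hψ : IsTestFunction ψ) :
    (hψ.toSchwartz : ℝ → ℂ) = fun x => (ψ x : ℂ) := rfl

theorem IsTestFunction.coe_fourier_toSchwartz {ψ : ℝ → ℝ} (hψ : IsTestFunction ψ) :
    ((𝓕 hψ.toSchwartz : 𝓢(ℝ, ℂ)) : ℝ → ℂ) = realFourier ψ := by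
  rw [SchwartzMap.fourier_coe, hψ.coe_toSchwartz, realFourier]

theorem IsTestFunction.fourierInv_realFourier {ψ : ℝ → ℝ} (hψ : IsTestFunction ψ) :
    𝓕⁻ (realFourier ψ) = fun x => (ψ x : ℂ) := by
  rw [← hψ.coe_fourier_toSchwartz, ← SchwartzMap.fourierInv_coe,
    FourierTransform.fourierInv_fourier_eq, hψ.coe_toSchwartz]

theorem realFourier_eq (ψ : ℝ → ℝ) (ξ : ℝ) :
    realFourier ψ ξ =
      ∫ x : ℝ, Complex.exp (((-2 * Real.pi * (x * ξ) : ℝ) : ℂ) * Complex.I) * ψ x := by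
  rw [realFourier, Real.fourier_eq']
  refine integral_congr_ae (Eventually.of_forall fun x => ?_)
  simp [mul_comm]

theorem fourierInv_eq_integral (f : ℝ → ℂ) (x : ℝ) :
    𝓕⁻ f x = ∫ ξ : ℝ, Complex.exp (((2 * Real.pi * (x * ξ) : ℝ) : ℂ) * Complex.I) * f ξ := by
  rw [Real.fourierInv_eq']
  rfl

/-- Multiplying the transform of a test function by a measurable function of polynomial growth
gives an element of every `Lᵖ`: the growth is absorbed by a Bessel potential, which maps Schwartz
functions to Schwartz functions. -/
theorem IsTestFunction.memLp_mul_realFourier {ψ : ℝ → ℝ} (hψ : IsTestFunction ψ) {s : ℝ}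
    (hs : 0 ≤ s) {m : ℝ → ℂ} (hm : Measurable m) (hb : ∀ ξ, ‖m ξ‖ = |2 * Real.pi * ξ| ^ s)
    (p : ENNReal) : MemLp (fun ξ => m ξ * realFourier ψ ξ) p := by
  have hg := Function.hasTemperateGrowth_one_add_norm_sq_rpow ℝ (s / 2)
  have hS := SchwartzMap.memLp (SchwartzMap.smulLeftCLM (𝕜 := ℝ) ℂ
    (fun x : ℝ => (1 + ‖x‖ ^ 2) ^ (s / 2)) (𝓕 hψ.toSchwartz)) p volume
  refine MemLp.of_le_mul (c := (2 * Real.pi) ^ s) hS ?_ (Eventually.of_forall fun ξ => ?_)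
  · refine hm.aestronglyMeasurable.mul ?_
    rw [← hψ.coe_fourier_toSchwartz]
    exact (SchwartzMap.continuous _).aestronglyMeasurable
  · rw [SchwartzMap.smulLeftCLM_apply_apply hg, hψ.coe_fourier_toSchwartz, norm_mul, norm_smul, hb,
      abs_mul, abs_of_pos Real.two_pi_pos,
      Real.mul_rpow Real.two_pi_pos.le (abs_nonneg ξ), mul_assoc]
    refine mul_le_mul_of_nonneg_left (mul_le_mul_of_nonneg_right ?_ (norm_nonneg _)) (by positivity)
    rw [Real.norm_of_nonneg (by positivity)]
    calc |ξ| ^ s = (|ξ| ^ (2 : ℝ)) ^ (s / 2) := by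
          rw [← Real.rpow_mul (abs_nonneg ξ)]; congr 1; ring
      _ ≤ (1 + ‖ξ‖ ^ 2) ^ (s / 2) := by
          refine Real.rpow_le_rpow (by positivity) ?_ (by positivity)
          rw [Real.rpow_two, Real.norm_eq_abs]; linarith

theorem IsTestFunction.memLp_realFourier {ψ : ℝ → ℝ} (hψ : IsTestFunction ψ) (p : ENNReal) :
    MemLp (realFourier ψ) p := by
  rw [← hψ.coe_fourier_toSchwartz]
  exact SchwartzMap.memLp _ p volume

theorem IsTestFunction.comp_sub {ψ : ℝ → ℝ} (hψ : IsTestFunction ψ) (h : ℝ) :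
    IsTestFunction fun x => ψ (x - h) :=
  ⟨hψ.1.comp (contDiff_id.sub contDiff_const),
    hψ.2.comp_homeomorph (Homeomorph.subRight h)⟩

theorem IsTestFunction.comp_neg {ψ : ℝ → ℝ} (hψ : IsTestFunction ψ) :
    IsTestFunction fun x => ψ (-x) :=
  ⟨hψ.1.comp contDiff_neg, hψ.2.comp_homeomorph (Homeomorph.neg ℝ)⟩

theorem realFourier_comp_sub (ψ : ℝ → ℝ) (h ξ : ℝ) :
    realFourier (fun x => ψ (x - h)) ξ =
      Complex.exp (((-2 * Real.pi * (h * ξ) : ℝ) : ℂ) * Complex.I) * realFourier ψ ξ := by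
  rw [realFourier_eq, realFourier_eq, ← integral_const_mul,
    ← integral_sub_right_eq_self (fun x : ℝ => Complex.exp _ *
      (Complex.exp (((-2 * Real.pi * (x * ξ) : ℝ) : ℂ) * Complex.I) * ψ x)) h]
  refine integral_congr_ae (Eventually.of_forall fun x => ?_)
  simp only
  rw [← mul_assoc (Complex.exp _), ← Complex.exp_add]
  congr 2
  push_cast
  ring

theorem realFourier_comp_neg (ψ : ℝ → ℝ) (ξ : ℝ) :
    realFourier (fun x => ψ (-x)) ξ = realFourier ψ (-ξ) := by
  rw [realFourier_eq, realFourier_eq, ← integral_neg_eq_self]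
  refine integral_congr_ae (Eventually.of_forall fun x => ?_)
  simp

/-- A bump function concentrated near the origin has a transform without zeros on a given
bounded interval, because the cosine is positive on its support. -/
theorem exists_realFourier_ne_zero (N : ℝ) :
    ∃ ψ : ℝ → ℝ, IsTestFunction ψ ∧ ∀ ξ, |ξ| ≤ N → realFourier ψ ξ ≠ 0 := by
  -- The radius `1 / (8 (|N| + 1))` makes `|2πxξ| ≤ π / 4` on the support when `|ξ| ≤ N`.
  have hN : 0 < 1 / (8 * (|N| + 1)) := by positivity
  let b : ContDiffBump (0 : ℝ) := ⟨1 / (8 * (|N| + 1)) / 2, 1 / (8 * (|N| + 1)), by positivity,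
    by linarith⟩
  refine ⟨b, ⟨b.contDiff, b.hasCompactSupport⟩, fun ξ hξ h0 => ?_⟩
  have hint : Integrable fun x : ℝ =>
      Complex.exp (((-2 * Real.pi * (x * ξ) : ℝ) : ℂ) * Complex.I) * b x := by
    refine Continuous.integrable_of_hasCompactSupport ?_ ?_
    · exact (by fun_prop : Continuous fun x : ℝ =>
        Complex.exp (((-2 * Real.pi * (x * ξ) : ℝ) : ℂ) * Complex.I)).mul
        (Complex.continuous_ofReal.comp b.continuous)
    · exact (b.hasCompactSupport.comp_left (g := fun y : ℝ => (y : ℂ))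
        Complex.ofReal_zero).mul_left
  have hre : ∫ x : ℝ, Real.cos (2 * Real.pi * (x * ξ)) * b x = 0 := by
    have := congrArg Complex.re (h0.symm.trans (realFourier_eq b ξ))
    rw [← RCLike.re_eq_complex_re, ← integral_re hint] at this
    rw [show RCLike.re (0 : ℂ) = (0 : ℝ) by simp] at this
    refine Eq.trans ?_ this.symm
    refine integral_congr_ae (Eventually.of_forall fun x => ?_)
    simp only [RCLike.re_eq_complex_re]
    rw [Complex.re_mul_ofReal, Complex.exp_ofReal_mul_I_re, ← Real.cos_neg]
    congr 2
    ring
  refine hre.not_gt (Continuous.integral_pos_of_hasCompactSupport_nonneg_nonzero (x := 0)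
    ?_ b.hasCompactSupport.mul_left ?_ ?_)
  · exact (by fun_prop : Continuous fun x : ℝ => Real.cos (2 * Real.pi * (x * ξ))).mul b.continuous
  · intro x
    by_cases hx : x ∈ Metric.ball (0 : ℝ) b.rOut
    · refine mul_nonneg (Real.cos_nonneg_of_mem_Icc (abs_le.1 ?_)) b.nonneg
      have hx' : |x| < 1 / (8 * (|N| + 1)) := by
        rw [← Real.norm_eq_abs]; exact mem_ball_zero_iff.1 hx
      have hxi : |x| * |ξ| ≤ 1 / (8 * (|N| + 1)) * (|N| + 1) :=
        mul_le_mul hx'.le (by linarith [le_abs_self N]) (abs_nonneg _) hN.le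
      have : 1 / (8 * (|N| + 1)) * (|N| + 1) = 1 / 8 := by
        have : |N| + 1 ≠ 0 := by positivity
        field_simp
      rw [abs_mul, abs_of_pos Real.two_pi_pos, abs_mul]
      nlinarith [Real.pi_pos]
    · have : b x = 0 := by
        rw [← Function.notMem_support, b.support_eq]; exact hx
      simp [this]
  · simp [b.one_of_mem_closedBall (x := 0) (Metric.mem_closedBall_self b.rIn_pos.le)]

/-- Transforms of test functions separate functions. Since translating a test function modulates
its transform, the hypothesis makes the inverse Fourier integral of `conj (realFourier ψ) * G`
vanish, and `ψ` may be chosen so that `realFourier ψ` has no zeros on a given interval. -/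
theorem ae_eq_zero_of_integral_realFourier {G : ℝ → ℂ}
    (hint : ∀ ψ, IsTestFunction ψ → Integrable fun ξ => conj (realFourier ψ ξ) * G ξ)
    (h : ∀ ψ, IsTestFunction ψ → ∫ ξ, conj (realFourier ψ ξ) * G ξ = 0) :
    G =ᵐ[volume] 0 := by
  have key : ∀ n : ℕ, ∀ᵐ ξ : ℝ, |ξ| ≤ n → G ξ = 0 := by
    intro n
    obtain ⟨ψ, hψ, hne⟩ := exists_realFourier_ne_zero n
    filter_upwards [ae_eq_zero_of_fourierInv_eq_zero (hint ψ hψ) fun x => by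
      rw [fourierInv_eq_integral, ← h _ (hψ.comp_sub x)]
      refine integral_congr_ae (Eventually.of_forall fun ξ => ?_)
      simp only [realFourier_comp_sub, map_mul, ← Complex.exp_conj, Complex.conj_ofReal,
        Complex.conj_I]
      rw [← mul_assoc]
      congr 3
      push_cast
      ring] with ξ hξ hle
    simpa [hne ξ hle] using hξ
  filter_upwards [ae_all_iff.2 key] with ξ hξ
  obtain ⟨n, hn⟩ := exists_nat_ge |ξ|
  exact hξ n hn

theorem norm_iPow (s η : ℝ) : ‖iPow s η‖ = |η| ^ s := by
  have h : (s * Real.pi * Complex.I * (SignType.sign η : ℝ) / 2 : ℂ) =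
      ((s * Real.pi * (SignType.sign η : ℝ) / 2 : ℝ) : ℂ) * Complex.I := by
    push_cast; ring
  rw [iPow, norm_mul, h, Complex.norm_exp_ofReal_mul_I, mul_one, Complex.norm_real,
    Real.norm_of_nonneg (by positivity)]

theorem conj_iPow (s η : ℝ) : conj (iPow s η) = iPow s (-η) := by
  have h : ((SignType.sign (-η) : ℝ) : ℂ) = -((SignType.sign η : ℝ) : ℂ) := by
    rw [Left.sign_neg]
    simp
  rw [iPow, iPow, map_mul, Complex.conj_ofReal, abs_neg, ← Complex.exp_conj, h]
  congr 2
  simp only [map_div₀, map_mul, Complex.conj_ofReal, Complex.conj_I, Complex.conj_ofNat]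
  ring

theorem measurable_iPow (s : ℝ) : Measurable (iPow s) := by
  have h : Measurable fun η : ℝ => (SignType.sign η : ℝ) := by
    have : (fun η : ℝ => (SignType.sign η : ℝ)) =
        fun η => if 0 < η then 1 else if η < 0 then -1 else 0 := by
      ext η
      rw [sign_apply]
      split_ifs <;> simp
    rw [this]
    exact Measurable.ite measurableSet_Ioi measurable_const
      (Measurable.ite measurableSet_Iio measurable_const measurable_const)
  unfold iPow
  have h' : Measurable fun η : ℝ => ((SignType.sign η : ℝ) : ℂ) := Complex.measurable_ofReal.comp h
  have h2 : Measurable fun η : ℝ => |η| ^ s := by fun_prop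
  exact (Complex.measurable_ofReal.comp h2).mul
    (Complex.measurable_exp.comp ((h'.const_mul _).div_const 2))

/-! ### Weak derivatives as Fourier multipliers -/

theorem coeFn_toComplex (v : L2) : (toComplex v : ℝ → ℂ) =ᵐ[volume] fun x => (v x : ℂ) :=
  ContinuousLinearMap.coeFn_compLp Complex.ofRealCLM v

theorem norm_toComplex (v : L2) : ‖toComplex v‖ = ‖v‖ := by
  rw [Lp.norm_def, Lp.norm_def]
  congr 1
  refine eLpNorm_congr_norm_ae ?_
  filter_upwards [coeFn_toComplex v] with x hx
  rw [hx, Complex.norm_real]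

theorem norm_plancherel (v : L2) : ‖plancherel v‖ = ‖v‖ := by
  rw [plancherel, Lp.norm_fourier_eq, norm_toComplex]

theorem integral_toComplex_mul (v : L2) (d : ℝ → ℝ) :
    ∫ x, toComplex v x * d x = ((∫ x, v x * d x : ℝ) : ℂ) := by
  rw [← integral_complex_ofReal]
  refine integral_congr_ae ?_
  filter_upwards [coeFn_toComplex v] with x hx
  rw [hx]
  push_cast
  rfl

/-- On test functions, `D` is the Fourier multiplier with symbol `conj m`, where `|m ξ| = |2πξ|^s`.
Its formal adjoint, the weak derivative defined by pairing with `D ψ`, then has symbol `m`. -/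
structure IsAdjointMultiplier (s : ℝ) (m : ℝ → ℂ) (D : (ℝ → ℝ) → ℝ → ℝ) : Prop where
  nonneg : 0 ≤ s
  measurable : Measurable m
  norm_eq : ∀ ξ, ‖m ξ‖ = |2 * Real.pi * ξ| ^ s
  apply_eq : ∀ ψ, IsTestFunction ψ → ∀ x,
    (D ψ x : ℂ) = 𝓕⁻ (fun ξ => conj (m ξ) * realFourier ψ ξ) x

variable {s : ℝ} {m : ℝ → ℂ} {D : (ℝ → ℝ) → ℝ → ℝ} {ψ : ℝ → ℝ}

theorem IsAdjointMultiplier.memLp (hD : IsAdjointMultiplier s m D) (hψ : IsTestFunction ψ)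
    (p : ENNReal) : MemLp (fun ξ => conj (m ξ) * realFourier ψ ξ) p :=
  hψ.memLp_mul_realFourier hD.nonneg (Complex.continuous_conj.measurable.comp hD.measurable)
    (fun ξ => by rw [Function.comp_apply, RCLike.norm_conj, hD.norm_eq]) p

theorem IsAdjointMultiplier.integral_mul_eq (hD : IsAdjointMultiplier s m D)
    (hψ : IsTestFunction ψ) (V : Lp ℂ 2 (volume : Measure ℝ)) :
    MemLp (D ψ) 2 ∧ ∫ x, V x * D ψ x =
      ∫ ξ, conj (realFourier ψ ξ) * (m ξ * (𝓕 V : Lp ℂ 2 (volume : Measure ℝ)) ξ) := by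
  obtain ⟨h1, h2⟩ := integral_mul_eq_of_fourierInv (memLp_one_iff_integrable.1 (hD.memLp hψ 1))
    (hD.memLp hψ 2) (hD.apply_eq ψ hψ) V
  refine ⟨h1, h2.trans (integral_congr_ae (Eventually.of_forall fun ξ => ?_))⟩
  simp only [map_mul, Complex.conj_conj]
  ring

theorem integral_mul_test_eq (hψ : IsTestFunction ψ) (V : Lp ℂ 2 (volume : Measure ℝ)) :
    ∫ x, V x * ψ x = ∫ ξ, conj (realFourier ψ ξ) * (𝓕 V : Lp ℂ 2 (volume : Measure ℝ)) ξ :=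
  (integral_mul_eq_of_fourierInv (memLp_one_iff_integrable.1 (hψ.memLp_realFourier 1))
    (hψ.memLp_realFourier 2) (fun x => by rw [hψ.fourierInv_realFourier]) V).2

theorem integrable_conj_realFourier_mul (hψ : IsTestFunction ψ)
    (V : Lp ℂ 2 (volume : Measure ℝ)) :
    Integrable fun ξ => conj (realFourier ψ ξ) * V ξ :=
  (hψ.memLp_realFourier 2).star.integrable_mul (Lp.memLp V)

theorem IsAdjointMultiplier.integrable_conj_realFourier_mul (hD : IsAdjointMultiplier s m D)
    (hψ : IsTestFunction ψ) (V : Lp ℂ 2 (volume : Measure ℝ)) :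
    Integrable fun ξ => conj (realFourier ψ ξ) * (m ξ * V ξ) := by
  refine ((hD.memLp hψ 2).star.integrable_mul (Lp.memLp V)).congr
    (Eventually.of_forall fun ξ => ?_)
  simp only [Pi.mul_apply, Pi.star_apply, RCLike.star_def, map_mul, Complex.conj_conj]
  ring

/-- A weak derivative in `L²` is given by multiplication with the symbol on the Fourier side. -/
theorem IsAdjointMultiplier.plancherel_ae_eq (hD : IsAdjointMultiplier s m D) {v w : L2}
    (h : ∀ ψ, IsTestFunction ψ → ∫ x, v x * D ψ x = ∫ x, w x * ψ x) :
    plancherel w =ᵐ[volume] fun ξ => m ξ * plancherel v ξ := by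
  have hsplit : ∀ ψ ξ, conj (realFourier ψ ξ) * (m ξ * plancherel v ξ - plancherel w ξ) =
      conj (realFourier ψ ξ) * (m ξ * plancherel v ξ) -
        conj (realFourier ψ ξ) * plancherel w ξ := fun ψ ξ => mul_sub _ _ _
  have h0 := ae_eq_zero_of_integral_realFourier
    (G := fun ξ => m ξ * plancherel v ξ - plancherel w ξ)
    (fun ψ hψ => by
      simp only [hsplit]
      exact (hD.integrable_conj_realFourier_mul hψ _).sub
        (FracSobolev.integrable_conj_realFourier_mul hψ _))
    (fun ψ hψ => by
      simp only [hsplit]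
      rw [integral_sub (hD.integrable_conj_realFourier_mul hψ _)
        (FracSobolev.integrable_conj_realFourier_mul hψ _), plancherel, plancherel,
        ← (hD.integral_mul_eq hψ _).2, ← integral_mul_test_eq hψ, integral_toComplex_mul,
        integral_toComplex_mul, h ψ hψ, sub_self])
  filter_upwards [h0] with ξ hξ
  exact (sub_eq_zero.1 hξ).symm

/-- If the symbol times the transform of `v` is square integrable, its inverse transform is a weak
derivative of `v`. It is real-valued because its pairings with real test functions are real. -/
theorem IsAdjointMultiplier.exists_pairing (hD : IsAdjointMultiplier s m D) {v : L2}
    (hv : MemLp (fun ξ => m ξ * plancherel v ξ) 2) :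
    ∃ w : L2, ∀ ψ, IsTestFunction ψ → ∫ x, v x * D ψ x = ∫ x, w x * ψ x := by
  let W : Lp ℂ 2 (volume : Measure ℝ) := 𝓕⁻ (hv.toLp _)
  have hFW : 𝓕 W = hv.toLp _ := FourierTransform.fourier_fourierInv_eq _
  have key : ∀ ψ, IsTestFunction ψ → ∫ x, W x * ψ x = ((∫ x, v x * D ψ x : ℝ) : ℂ) := by
    intro ψ hψ
    rw [integral_mul_test_eq hψ, hFW, ← integral_toComplex_mul, (hD.integral_mul_eq hψ _).2]
    refine integral_congr_ae ?_
    filter_upwards [hv.coeFn_toLp] with ξ hξ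
    rw [hξ, plancherel]
  have hre : MemLp (fun x => (W x).re) 2 := (Lp.memLp W).re
  refine ⟨hre.toLp _, fun ψ hψ => ?_⟩
  have hWint : Integrable fun x => W x * ψ x := by
    have hψ2 : MemLp (fun x => (ψ x : ℂ)) 2 := by
      rw [← hψ.coe_toSchwartz]; exact SchwartzMap.memLp _ 2 volume
    exact (Lp.memLp W).integrable_mul hψ2
  have h1 := congrArg Complex.re (key ψ hψ)
  rw [Complex.ofReal_re, ← RCLike.re_eq_complex_re, ← integral_re hWint] at h1
  rw [← h1]
  refine integral_congr_ae ?_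
  filter_upwards [hre.coeFn_toLp] with x hx
  rw [hx, RCLike.re_eq_complex_re, Complex.re_mul_ofReal]

theorem IsAdjointMultiplier.integrable_mul (hD : IsAdjointMultiplier s m D)
    (hψ : IsTestFunction ψ) (v : L2) : Integrable fun x => v x * D ψ x :=
  (Lp.memLp v).integrable_mul (hD.integral_mul_eq hψ (toComplex v)).1

theorem IsAdjointMultiplier.mem_HF_iff (hD : IsAdjointMultiplier s m D) (v : L2) :
    v ∈ HF s ↔ MemLp (fun ξ => m ξ * plancherel v ξ) 2 := by
  have hms : AEStronglyMeasurable (fun ξ => m ξ * plancherel v ξ) volume :=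
    hD.measurable.aestronglyMeasurable.mul (Lp.aestronglyMeasurable _)
  have hv : Integrable fun ξ => ‖plancherel v ξ‖ ^ 2 :=
    (memLp_two_iff_integrable_sq_norm (Lp.aestronglyMeasurable _)).1 (Lp.memLp (plancherel v))
  have heq : ∀ ξ, (1 + |2 * Real.pi * ξ| ^ (2 * s)) * ‖plancherel v ξ‖ ^ 2 =
      ‖plancherel v ξ‖ ^ 2 + ‖m ξ * plancherel v ξ‖ ^ 2 := by
    intro ξ
    rw [norm_mul, hD.norm_eq, mul_pow, ← Real.rpow_mul_natCast (abs_nonneg _)]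
    push_cast
    rw [mul_comm s 2]
    ring
  rw [memLp_two_iff_integrable_sq_norm hms]
  change Integrable (fun ξ => (1 + |2 * Real.pi * ξ| ^ (2 * s)) * ‖plancherel v ξ‖ ^ 2) ↔ _
  simp only [heq]
  exact ⟨fun h => (h.sub hv).congr (Eventually.of_forall fun ξ => by simp), fun h => hv.add h⟩

theorem IsAdjointMultiplier.mem_HF_iff_exists (hD : IsAdjointMultiplier s m D) (v : L2) :
    v ∈ HF s ↔ ∃ w : L2, LocallyIntegrable v ∧ LocallyIntegrable w ∧
      ∀ ψ : ℝ → ℝ, IsTestFunction ψ → Integrable (fun x => v x * D ψ x) ∧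
        ∫ x, v x * D ψ x = ∫ x, w x * ψ x := by
  rw [hD.mem_HF_iff]
  constructor
  · intro hv
    obtain ⟨w, hw⟩ := hD.exists_pairing hv
    exact ⟨w, L2.locallyIntegrable v, L2.locallyIntegrable w, fun ψ hψ =>
      ⟨hD.integrable_mul hψ v, hw ψ hψ⟩⟩
  · rintro ⟨w, -, -, hw⟩
    exact (memLp_congr_ae (hD.plancherel_ae_eq fun ψ hψ => (hw ψ hψ).2)).1 (Lp.memLp _)

theorem norm_eq_seminormHF (hb : ∀ ξ, ‖m ξ‖ = |2 * Real.pi * ξ| ^ s) {v w : L2} (hv : v ∈ HF s)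
    (h : plancherel w =ᵐ[volume] fun ξ => m ξ * plancherel v ξ) :
    ‖w‖ = seminormHF ⟨v, hv⟩ := by
  rw [← norm_plancherel, Lp.norm_def, seminormHF]
  congr 1
  refine eLpNorm_congr_norm_ae ?_
  filter_upwards [h] with ξ hξ
  rw [hξ, norm_mul, hb, Real.norm_of_nonneg (by positivity)]

/-! ### The power kernel and its Laplace transform -/

/-- The kernel `t₊^(σ-1)`, whose convolution with `w` is `Γ(σ)` times the left
Riemann–Liouville integral of `w`. -/
noncomputable def powKernel (σ : ℝ) : ℝ → ℝ := (Ioi 0).indicator fun t => t ^ (σ - 1)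

theorem measurable_powKernel (σ : ℝ) : Measurable (powKernel σ) :=
  (by fun_prop : Measurable fun t : ℝ => t ^ (σ - 1)).indicator measurableSet_Ioi

theorem powKernel_nonneg (σ t : ℝ) : 0 ≤ powKernel σ t :=
  indicator_nonneg (fun t (ht : 0 < t) => Real.rpow_nonneg ht.le _) t

theorem powKernel_of_pos (σ : ℝ) {t : ℝ} (ht : 0 < t) : powKernel σ t = t ^ (σ - 1) :=
  indicator_of_mem (mem_Ioi.2 ht) _

theorem powKernel_of_nonpos (σ : ℝ) {t : ℝ} (ht : t ≤ 0) : powKernel σ t = 0 :=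
  indicator_of_notMem (by simpa using ht) _

theorem locallyIntegrable_powKernel {σ : ℝ} (hσ : 0 < σ) : LocallyIntegrable (powKernel σ) := by
  intro x
  refine ⟨Ioc (x - 1) (x + 1), Ioc_mem_nhds (by linarith) (by linarith), ?_⟩
  have h := intervalIntegral.intervalIntegrable_rpow' (a := x - 1) (b := x + 1) (r := σ - 1)
    (by linarith)
  rw [intervalIntegrable_iff_integrableOn_Ioc_of_le (by linarith)] at h
  exact Integrable.indicator h measurableSet_Ioi

theorem integrable_powKernel_mul_exp {σ b : ℝ} (hσ : 0 < σ) (hb : 0 < b) :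
    Integrable fun t => powKernel σ t * Real.exp (-b * t) := by
  have h := integrableOn_rpow_mul_exp_neg_mul_rpow (p := 1) (s := σ - 1) (by linarith) one_pos hb
  rw [← integrable_indicator_iff measurableSet_Ioi] at h
  refine h.congr (Eventually.of_forall fun t => ?_)
  beta_reduce
  rcases lt_or_ge 0 t with ht | ht
  · rw [indicator_of_mem (mem_Ioi.2 ht), powKernel_of_pos σ ht, Real.rpow_one]
  · rw [indicator_of_notMem (by simpa using ht), powKernel_of_nonpos σ ht, zero_mul]

theorem integrable_powKernel_mul_cexp {σ : ℝ} (hσ : 0 < σ) {z : ℂ} (hz : 0 < z.re) :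
    Integrable fun t : ℝ => (powKernel σ t : ℂ) * Complex.exp (-z * t) := by
  refine (integrable_powKernel_mul_exp hσ hz).mono' ?_ (Eventually.of_forall fun t => ?_)
  · exact ((Complex.measurable_ofReal.comp (measurable_powKernel σ)).mul
      (by fun_prop)).aestronglyMeasurable
  · rw [norm_mul, Complex.norm_real, Real.norm_of_nonneg (powKernel_nonneg σ t), Complex.norm_exp]
    simp

theorem differentiableAt_integral_powKernel_mul_cexp {σ : ℝ} (hσ : 0 < σ) {z : ℂ}
    (hz : 0 < z.re) :
    DifferentiableAt ℂ (fun w : ℂ => ∫ t : ℝ, (powKernel σ t : ℂ) * Complex.exp (-w * t)) z := by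
  have hK : Measurable fun t : ℝ => (powKernel σ t : ℂ) :=
    Complex.measurable_ofReal.comp (measurable_powKernel σ)
  refine (hasDerivAt_integral_of_dominated_loc_of_deriv_le
    (bound := fun t => powKernel (σ + 1) t * Real.exp (-(z.re / 2) * t))
    (F' := fun (w : ℂ) (t : ℝ) => (powKernel σ t : ℂ) * (Complex.exp (-w * t) * (-t)))
    (s := {w : ℂ | z.re / 2 < w.re})
    ((isOpen_lt continuous_const Complex.continuous_re).mem_nhds (by
      simpa using hz))
    (Eventually.of_forall fun w => (hK.mul (by fun_prop)).aestronglyMeasurable)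
    (integrable_powKernel_mul_cexp hσ hz)
    (hK.mul (by fun_prop)).aestronglyMeasurable
    (Eventually.of_forall fun t w hw => ?_)
    (integrable_powKernel_mul_exp (by linarith) (by linarith))
    (Eventually.of_forall fun t w _ => ?_)).2.differentiableAt
  · rcases lt_or_ge 0 t with ht | ht
    · rw [powKernel_of_pos _ ht, powKernel_of_pos _ ht, norm_mul, norm_mul, Complex.norm_exp,
        Complex.norm_real, norm_neg, Complex.norm_real, Real.norm_of_nonneg (by positivity),
        Real.norm_of_nonneg ht.le, add_sub_cancel_right]
      have h1 : t ^ (σ - 1) * t = t ^ σ := by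
        rw [← Real.rpow_add_one ht.ne', sub_add_cancel]
      have h2 : (-w * (t : ℂ)).re ≤ -(z.re / 2) * t := by
        have hw' : z.re / 2 < w.re := hw
        have : (-w * (t : ℂ)).re = -w.re * t := by simp
        rw [this]
        nlinarith
      calc t ^ (σ - 1) * (Real.exp (-w * (t : ℂ)).re * t)
          = t ^ σ * Real.exp (-w * (t : ℂ)).re := by rw [← h1]; ring
        _ ≤ t ^ σ * Real.exp (-(z.re / 2) * t) :=
          mul_le_mul_of_nonneg_left (Real.exp_le_exp.2 h2) (by positivity)
    · simp [powKernel_of_nonpos _ ht]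
  · have h : HasDerivAt (fun w : ℂ => -w * (t : ℂ)) (-(t : ℂ)) w := by
      simpa using (hasDerivAt_id w).neg.mul_const (t : ℂ)
    exact h.cexp.const_mul _

/-- The Laplace transform of the power kernel on the right half-plane. The identity extends from
the positive real axis by analytic continuation. -/
theorem integral_powKernel_mul_cexp {σ : ℝ} (hσ : 0 < σ) {z : ℂ} (hz : 0 < z.re) :
    ∫ t : ℝ, (powKernel σ t : ℂ) * Complex.exp (-z * t) =
      (Real.Gamma σ : ℂ) * (1 / z) ^ (σ : ℂ) := by
  have hopen : IsOpen {w : ℂ | 0 < w.re} := isOpen_lt continuous_const Complex.continuous_re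
  have hf : AnalyticOnNhd ℂ (fun w : ℂ => ∫ t : ℝ, (powKernel σ t : ℂ) * Complex.exp (-w * t))
      {w : ℂ | 0 < w.re} :=
    DifferentiableOn.analyticOnNhd (fun w hw =>
      (differentiableAt_integral_powKernel_mul_cexp hσ hw).differentiableWithinAt) hopen
  have hg : AnalyticOnNhd ℂ (fun w : ℂ => (Real.Gamma σ : ℂ) * (1 / w) ^ (σ : ℂ))
      {w : ℂ | 0 < w.re} := by
    refine DifferentiableOn.analyticOnNhd (fun w hw => ?_) hopen
    have hw' : 0 < w.re := hw
    have hw0 : w ≠ 0 := fun h => by simp [h] at hw'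
    refine DifferentiableAt.differentiableWithinAt (DifferentiableAt.const_mul ?_ _)
    refine DifferentiableAt.cpow_const (by fun_prop (disch := assumption)) (Or.inl ?_)
    rw [one_div, Complex.inv_re]
    exact div_pos hw (Complex.normSq_pos.2 hw0)
  refine hf.eqOn_of_preconnected_of_frequently_eq hg (convex_halfSpace_re_gt 0).isPreconnected
    (z₀ := 1) (by simp) ?_ hz
  have hreal : ∀ᶠ r : ℝ in 𝓝[≠] 1, (∫ t : ℝ, (powKernel σ t : ℂ) * Complex.exp (-(r : ℂ) * t)) =
      (Real.Gamma σ : ℂ) * (1 / (r : ℂ)) ^ (σ : ℂ) := by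
    filter_upwards [nhdsWithin_le_nhds (lt_mem_nhds one_pos)] with r hr
    have h := Complex.integral_cpow_mul_exp_neg_mul_Ioi (a := σ) (by simpa using hσ) hr
    rw [Complex.Gamma_ofReal, mul_comm] at h
    rw [← h, ← integral_indicator measurableSet_Ioi]
    refine integral_congr_ae (Eventually.of_forall fun t => ?_)
    rcases lt_or_ge 0 t with ht | ht
    · simp only [indicator_of_mem (mem_Ioi.2 ht), powKernel_of_pos σ ht]
      rw [Complex.ofReal_cpow ht.le]
      push_cast
      rw [neg_mul]
    · simp only [indicator_of_notMem (show t ∉ Ioi 0 by simpa using ht),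
        powKernel_of_nonpos σ ht]
      simp
  have hmap : Tendsto (fun r : ℝ => (r : ℂ)) (𝓝[≠] 1) (𝓝[≠] 1) := by
    refine tendsto_nhdsWithin_iff.2 ⟨?_, ?_⟩
    · exact (Complex.continuous_ofReal.tendsto' 1 1 (by simp)).mono_left nhdsWithin_le_nhds
    · filter_upwards [self_mem_nhdsWithin] with r hr
      simpa using hr
  exact hmap.frequently hreal.frequently

/-! ### The symbol -/

theorem iPow_eq_cpow (s : ℝ) {η : ℝ} (hη : η ≠ 0) : iPow s η = (Complex.I * η) ^ (s : ℂ) := by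
  have hne : Complex.I * (η : ℂ) ≠ 0 := mul_ne_zero Complex.I_ne_zero (by exact_mod_cast hη)
  have harg : (Complex.I * (η : ℂ)).arg = Real.pi / 2 * (SignType.sign η : ℝ) := by
    rcases lt_or_gt_of_ne hη with h | h
    · rw [show Complex.I * (η : ℂ) = ((-η : ℝ) : ℂ) * -Complex.I by push_cast; ring,
        Complex.arg_real_mul _ (by linarith), Complex.arg_neg_I, sign_neg h]
      simp
    · rw [mul_comm, Complex.arg_real_mul _ h, Complex.arg_I, sign_pos h]
      simp
  have hnorm : ‖Complex.I * (η : ℂ)‖ = |η| := by simp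
  have habs : 0 < |η| := abs_pos.2 hη
  rw [Complex.cpow_def_of_ne_zero hne, Complex.log, hnorm, harg, iPow, Real.rpow_def_of_pos habs,
    Complex.ofReal_exp, ← Complex.exp_add]
  congr 1
  push_cast
  ring

/-- The symbol of the fractional integral of order `σ` times that of the `n`-th derivative. -/
theorem one_div_cpow_mul_pow {s σ : ℝ} {n : ℕ} (h : (n : ℝ) - σ = s) {η : ℝ} (hη : η ≠ 0) :
    (1 / (Complex.I * η)) ^ (σ : ℂ) * (Complex.I * η) ^ n = iPow s η := by
  have hne : Complex.I * (η : ℂ) ≠ 0 := mul_ne_zero Complex.I_ne_zero (by exact_mod_cast hη)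
  have harg : (Complex.I * (η : ℂ)).arg ≠ Real.pi := by
    intro h
    have := (Complex.arg_eq_pi_iff.1 h).1
    simp at this
  rw [iPow_eq_cpow s hη, one_div, Complex.inv_cpow _ _ harg, ← Complex.cpow_natCast,
    ← Complex.cpow_neg, ← Complex.cpow_add _ _ hne, ← h]
  congr 1
  push_cast
  ring

/-! ### Derivatives of test functions and of the fractional integral -/

theorem IsTestFunction.deriv {ψ : ℝ → ℝ} (hψ : IsTestFunction ψ) : IsTestFunction (deriv ψ) :=
  ⟨(contDiff_infty_iff_deriv.1 hψ.1).2, hψ.2.deriv⟩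

theorem IsTestFunction.iteratedDeriv {ψ : ℝ → ℝ} (hψ : IsTestFunction ψ) (n : ℕ) :
    IsTestFunction (iteratedDeriv n ψ) := by
  induction n with
  | zero => simpa using hψ
  | succ n ih => rw [iteratedDeriv_succ]; exact ih.deriv

theorem IsTestFunction.realFourier_deriv {ψ : ℝ → ℝ} (hψ : IsTestFunction ψ) (ξ : ℝ) :
    realFourier (_root_.deriv ψ) ξ =
      (Complex.I * (2 * Real.pi * ξ : ℝ)) * realFourier ψ ξ := by
  have hd : _root_.deriv (fun x => (ψ x : ℂ)) = fun x => ((_root_.deriv ψ x : ℝ) : ℂ) :=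
    funext fun x => ((hψ.1.differentiable (by simp)) x).hasDerivAt.ofReal_comp.deriv
  have hint : ∀ {φ : ℝ → ℝ}, IsTestFunction φ → Integrable fun x => (φ x : ℂ) := fun hφ => by
    rw [← hφ.coe_toSchwartz]; exact SchwartzMap.integrable _
  have h := Real.fourier_deriv (hint hψ)
    (Complex.ofRealCLM.differentiable.comp (hψ.1.differentiable (by simp)))
    (by rw [hd]; exact hint hψ.deriv)
  rw [hd] at h
  rw [realFourier, h, realFourier]
  simp only [smul_eq_mul]
  push_cast
  ring

theorem IsTestFunction.realFourier_iteratedDeriv {ψ : ℝ → ℝ} (hψ : IsTestFunction ψ) (n : ℕ)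
    (ξ : ℝ) : realFourier (_root_.iteratedDeriv n ψ) ξ =
      (Complex.I * (2 * Real.pi * ξ : ℝ)) ^ n * realFourier ψ ξ := by
  induction n with
  | zero => simp
  | succ n ih => rw [iteratedDeriv_succ, (hψ.iteratedDeriv n).realFourier_deriv, ih]; ring

theorem leftRLIntegral_eq (σ : ℝ) (w : ℝ → ℝ) :
    leftRLIntegral σ w =
      fun x => 1 / Real.Gamma σ *
        convolution (powKernel σ) w (ContinuousLinearMap.mul ℝ ℝ) volume x := by
  ext x
  rw [leftRLIntegral, convolution_mul, ← integral_indicator measurableSet_Iio,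
    ← integral_sub_left_eq_self _ volume x]
  congr 2
  ext t
  rcases lt_or_ge 0 t with ht | ht
  · rw [indicator_of_mem (show x - t ∈ Iio x by simpa using ht), powKernel_of_pos σ ht]
    simp
  · rw [indicator_of_notMem (show x - t ∉ Iio x by simpa using ht), powKernel_of_nonpos σ ht,
      zero_mul]

theorem iteratedDeriv_convolution_powKernel {σ : ℝ} (hσ : 0 < σ) {ψ : ℝ → ℝ}
    (hψ : IsTestFunction ψ) (n : ℕ) :
    iteratedDeriv n (convolution (powKernel σ) ψ (ContinuousLinearMap.mul ℝ ℝ) volume) =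
      convolution (powKernel σ) (iteratedDeriv n ψ) (ContinuousLinearMap.mul ℝ ℝ) volume := by
  induction n with
  | zero => simp
  | succ n ih =>
    rw [iteratedDeriv_succ, iteratedDeriv_succ, ih]
    exact funext fun x => (HasCompactSupport.hasDerivAt_convolution_right _
      (locallyIntegrable_powKernel hσ) (hψ.iteratedDeriv n).2
      ((hψ.iteratedDeriv n).1.of_le (by exact_mod_cast le_top)) x).deriv

/-- All derivatives fall on the test function, because the power kernel is locally integrable. -/
theorem leftRLDeriv_eq {s : ℝ} {ψ : ℝ → ℝ} (hψ : IsTestFunction ψ) (x : ℝ)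
    (hσ : 0 < ((⌊s⌋₊ + 1 : ℕ) : ℝ) - s) :
    leftRLDeriv s ψ x = 1 / Real.Gamma (((⌊s⌋₊ + 1 : ℕ) : ℝ) - s) *
      ∫ t, powKernel (((⌊s⌋₊ + 1 : ℕ) : ℝ) - s) t * iteratedDeriv (⌊s⌋₊ + 1) ψ (x - t) := by
  rw [leftRLDeriv, leftRLIntegral_eq, iteratedDeriv_const_mul_field,
    iteratedDeriv_convolution_powKernel hσ hψ, convolution_mul]

/-! ### The Fourier symbol of the Riemann–Liouville derivatives -/

/-- The exponentially damped fractional integral, expressed by Fourier inversion and Fubini. -/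
theorem integral_powKernel_mul_exp_mul {σ ε : ℝ} (hσ : 0 < σ) (hε : 0 < ε) {φ : ℝ → ℝ}
    (hφ : IsTestFunction φ) (x : ℝ) :
    ∫ t : ℝ, (powKernel σ t : ℂ) * Complex.exp (-(ε : ℂ) * t) * φ (x - t) =
      ∫ ξ : ℝ, Complex.exp (((2 * Real.pi * (x * ξ) : ℝ) : ℂ) * Complex.I) *
        (Real.Gamma σ * ((1 / (ε + Complex.I * (2 * Real.pi * ξ : ℝ))) ^ (σ : ℂ) *
          realFourier φ ξ)) := by
  have hφ1 : Integrable (realFourier φ) := memLp_one_iff_integrable.1 (hφ.memLp_realFourier 1)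
  have hinv : ∀ y, (φ y : ℂ) =
      ∫ ξ : ℝ, Complex.exp (((2 * Real.pi * (y * ξ) : ℝ) : ℂ) * Complex.I) * realFourier φ ξ := by
    intro y
    rw [← fourierInv_eq_integral, hφ.fourierInv_realFourier]
  have hK := integrable_powKernel_mul_cexp hσ (z := (ε : ℂ)) (by simpa using hε)
  calc ∫ t : ℝ, (powKernel σ t : ℂ) * Complex.exp (-(ε : ℂ) * t) * φ (x - t)
      = ∫ t : ℝ, ∫ ξ : ℝ, Complex.exp (((2 * Real.pi * ((x - t) * ξ) : ℝ) : ℂ) * Complex.I) *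
          (((powKernel σ t : ℂ) * Complex.exp (-(ε : ℂ) * t)) * realFourier φ ξ) := by
        refine integral_congr_ae (Eventually.of_forall fun t => ?_)
        simp only
        rw [hinv, ← integral_const_mul]
        refine integral_congr_ae (Eventually.of_forall fun ξ => ?_)
        simp only
        ring
    _ = ∫ ξ : ℝ, ∫ t : ℝ, Complex.exp (((2 * Real.pi * ((x - t) * ξ) : ℝ) : ℂ) * Complex.I) *
          (((powKernel σ t : ℂ) * Complex.exp (-(ε : ℂ) * t)) * realFourier φ ξ) := by
        refine integral_integral_swap ((hK.mul_prod hφ1).bdd_mul (c := 1)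
          (f := fun z : ℝ × ℝ =>
            Complex.exp (((2 * Real.pi * ((x - z.1) * z.2) : ℝ) : ℂ) * Complex.I)) ?_ ?_)
        · exact (by fun_prop : Continuous _).aestronglyMeasurable
        · exact Eventually.of_forall fun z => (Complex.norm_exp_ofReal_mul_I _).le
    _ = _ := by
        refine integral_congr_ae (Eventually.of_forall fun ξ => ?_)
        simp only
        have hz : 0 < ((ε : ℂ) + Complex.I * (2 * Real.pi * ξ : ℝ)).re := by simpa using hε
        rw [← mul_assoc (Real.Gamma σ : ℂ), ← integral_powKernel_mul_cexp hσ hz,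
          ← integral_mul_const, ← integral_const_mul]
        refine integral_congr_ae (Eventually.of_forall fun t => ?_)
        simp only
        have hexp : Complex.exp (((2 * Real.pi * ((x - t) * ξ) : ℝ) : ℂ) * Complex.I) *
            Complex.exp (-(ε : ℂ) * t) =
            Complex.exp (((2 * Real.pi * (x * ξ) : ℝ) : ℂ) * Complex.I) *
              Complex.exp (-((ε : ℂ) + Complex.I * (2 * Real.pi * ξ : ℝ)) * t) := by
          rw [← Complex.exp_add, ← Complex.exp_add]
          congr 1
          push_cast
          ring
        linear_combination (powKernel σ t : ℂ) * realFourier φ ξ * hexp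

/-- Removing the damping: on the left the kernel is integrable against the compactly supported
function `φ`, on the right the singularity of the symbol at the origin is dominated. -/
theorem integral_powKernel_mul {σ : ℝ} (hσ : 0 < σ) {φ : ℝ → ℝ} (hφ : IsTestFunction φ)
    (hint : Integrable fun ξ : ℝ =>
      (1 / (Complex.I * (2 * Real.pi * ξ : ℝ))) ^ (σ : ℂ) * realFourier φ ξ) (x : ℝ) :
    ((∫ t, powKernel σ t * φ (x - t) : ℝ) : ℂ) =
      ∫ ξ : ℝ, Complex.exp (((2 * Real.pi * (x * ξ) : ℝ) : ℂ) * Complex.I) *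
        (Real.Gamma σ * ((1 / (Complex.I * (2 * Real.pi * ξ : ℝ))) ^ (σ : ℂ) *
          realFourier φ ξ)) := by
  have hpos : ∀ᶠ ε : ℝ in 𝓝[>] 0, 0 < ε := self_mem_nhdsWithin
  have hlim : Tendsto (fun ε : ℝ => (ε : ℂ)) (𝓝[>] 0) (𝓝 0) :=
    (Complex.continuous_ofReal.tendsto' 0 0 (by simp)).mono_left nhdsWithin_le_nhds
  have hφm : Measurable fun t : ℝ => (φ (x - t) : ℂ) :=
    Complex.measurable_ofReal.comp (hφ.1.continuous.measurable.comp (by fun_prop))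
  have hK : Measurable fun t : ℝ => (powKernel σ t : ℂ) :=
    Complex.measurable_ofReal.comp (measurable_powKernel σ)
  have hφ' : Measurable (realFourier φ) := by
    rw [← hφ.coe_fourier_toSchwartz]; exact (SchwartzMap.continuous _).measurable
  have hL : Tendsto
      (fun ε : ℝ => ∫ t : ℝ, (powKernel σ t : ℂ) * Complex.exp (-(ε : ℂ) * t) * φ (x - t))
      (𝓝[>] 0) (𝓝 (∫ t : ℝ, (powKernel σ t : ℂ) * φ (x - t))) := by
    have hb : Integrable fun t : ℝ => powKernel σ t * φ (x - t) := by
      refine (locallyIntegrable_powKernel hσ).integrable_smul_right_of_hasCompactSupport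
        (hφ.1.continuous.comp (continuous_const.sub continuous_id)) ?_
      exact hφ.2.comp_homeomorph (Homeomorph.subLeft x)
    refine tendsto_integral_filter_of_dominated_convergence
      (fun t => ‖powKernel σ t * φ (x - t)‖) ?_ ?_ hb.norm ?_
    · exact Eventually.of_forall fun ε =>
        ((hK.mul (by fun_prop)).mul hφm).aestronglyMeasurable
    · filter_upwards [hpos] with ε hε
      refine Eventually.of_forall fun t => ?_
      rcases lt_or_ge 0 t with ht | ht
      · have h1 : ‖Complex.exp (-(ε : ℂ) * t)‖ ≤ 1 := by
          rw [Complex.norm_exp, Real.exp_le_one_iff]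
          have : (-(ε : ℂ) * t).re = -(ε * t) := by simp
          rw [this]
          nlinarith
        rw [norm_mul, norm_mul, norm_mul, Complex.norm_real, Complex.norm_real]
        exact mul_le_mul_of_nonneg_right (mul_le_of_le_one_right (norm_nonneg _) h1)
          (norm_nonneg _)
      · simp [powKernel_of_nonpos σ ht]
    · refine Eventually.of_forall fun t => Tendsto.mul_const _ ?_
      have h1 : Tendsto (fun ε : ℝ => Complex.exp (-(ε : ℂ) * t)) (𝓝[>] 0) (𝓝 1) := by
        have h2 : Continuous fun z : ℂ => Complex.exp (-z * t) := by fun_prop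
        exact (h2.tendsto' 0 1 (by simp)).comp hlim
      simpa using h1.const_mul (powKernel σ t : ℂ)
  have hR : Tendsto
      (fun ε : ℝ => ∫ ξ : ℝ, Complex.exp (((2 * Real.pi * (x * ξ) : ℝ) : ℂ) * Complex.I) *
        (Real.Gamma σ * ((1 / (ε + Complex.I * (2 * Real.pi * ξ : ℝ))) ^ (σ : ℂ) *
          realFourier φ ξ)))
      (𝓝[>] 0) (𝓝 (∫ ξ : ℝ, Complex.exp (((2 * Real.pi * (x * ξ) : ℝ) : ℂ) * Complex.I) *
        (Real.Gamma σ * ((1 / (Complex.I * (2 * Real.pi * ξ : ℝ))) ^ (σ : ℂ) *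
          realFourier φ ξ)))) := by
    have hne : ∀ᵐ ξ : ℝ, 2 * Real.pi * ξ ≠ 0 := by
      filter_upwards [Measure.ae_ne volume (0 : ℝ)] with ξ hξ
      exact mul_ne_zero Real.two_pi_pos.ne' hξ
    refine tendsto_integral_filter_of_dominated_convergence
      (fun ξ : ℝ => ‖(Real.Gamma σ : ℂ)‖ *
        ‖(1 / (Complex.I * (2 * Real.pi * ξ : ℝ))) ^ (σ : ℂ) * realFourier φ ξ‖)
      ?_ ?_ (hint.norm.const_mul _) ?_
    · refine Eventually.of_forall fun ε => Measurable.aestronglyMeasurable ?_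
      exact (by fun_prop : Measurable fun ξ : ℝ =>
        Complex.exp (((2 * Real.pi * (x * ξ) : ℝ) : ℂ) * Complex.I)).mul
        (Measurable.const_mul (Measurable.mul (by fun_prop) hφ') _)
    · filter_upwards [hpos] with ε hε
      filter_upwards [hne] with ξ hξ
      rw [norm_mul, Complex.norm_exp_ofReal_mul_I, one_mul, norm_mul, norm_mul, norm_mul,
        Complex.norm_cpow_real, Complex.norm_cpow_real]
      refine mul_le_mul_of_nonneg_left (mul_le_mul_of_nonneg_right
        (Real.rpow_le_rpow (norm_nonneg _) ?_ hσ.le) (norm_nonneg _)) (norm_nonneg _)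
      rw [norm_div, norm_div]
      refine div_le_div_of_nonneg_left (norm_nonneg _) ?_ ?_
      · exact norm_pos_iff.2 (mul_ne_zero Complex.I_ne_zero (by exact_mod_cast hξ))
      · rw [norm_mul, Complex.norm_I, one_mul, Complex.norm_real, Real.norm_eq_abs]
        have := Complex.abs_im_le_norm ((ε : ℂ) + Complex.I * (2 * Real.pi * ξ : ℝ))
        simpa using this
    · filter_upwards [hne] with ξ hξ
      refine Tendsto.const_mul _ (Tendsto.const_mul _ (Tendsto.mul_const _ ?_))
      have hξ' : Complex.I * ((2 * Real.pi * ξ : ℝ) : ℂ) ≠ 0 :=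
        mul_ne_zero Complex.I_ne_zero (by exact_mod_cast hξ)
      have hslit : 1 / (Complex.I * ((2 * Real.pi * ξ : ℝ) : ℂ)) ∈ Complex.slitPlane := by
        refine Complex.mem_slitPlane_iff.2 (Or.inr ?_)
        rw [one_div, Complex.inv_im]
        refine div_ne_zero ?_ (Complex.normSq_pos.2 hξ').ne'
        simpa using hξ
      refine ((continuousAt_cpow_const hslit).tendsto).comp ?_
      refine Tendsto.div tendsto_const_nhds ?_ hξ'
      simpa using hlim.add_const (Complex.I * ((2 * Real.pi * ξ : ℝ) : ℂ))
  have heq : ((∫ t, powKernel σ t * φ (x - t) : ℝ) : ℂ) =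
      ∫ t : ℝ, (powKernel σ t : ℂ) * φ (x - t) := by
    rw [← integral_complex_ofReal]
    push_cast
    rfl
  rw [heq]
  refine tendsto_nhds_unique hL (hR.congr' ?_)
  filter_upwards [hpos] with ε hε
  rw [integral_powKernel_mul_exp_mul hσ hε hφ]

theorem measurable_iPow_two_pi (s : ℝ) : Measurable fun ξ : ℝ => iPow s (2 * Real.pi * ξ) :=
  (measurable_iPow s).comp (by fun_prop)

/-- The left Riemann–Liouville derivative of a test function has symbol `(2πiξ)^s`. -/
theorem leftRLDeriv_eq_fourierInv {s : ℝ} (hs : 0 ≤ s) {ψ : ℝ → ℝ} (hψ : IsTestFunction ψ)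
    (x : ℝ) : (leftRLDeriv s ψ x : ℂ) =
      𝓕⁻ (fun ξ => iPow s (2 * Real.pi * ξ) * realFourier ψ ξ) x := by
  have hσ : 0 < ((⌊s⌋₊ + 1 : ℕ) : ℝ) - s := by
    push_cast
    linarith [Nat.lt_floor_add_one s]
  have hsym : (fun ξ : ℝ => (1 / (Complex.I * (2 * Real.pi * ξ : ℝ))) ^
      (((((⌊s⌋₊ + 1 : ℕ) : ℝ) - s : ℝ)) : ℂ) * realFourier (iteratedDeriv (⌊s⌋₊ + 1) ψ) ξ)
      =ᵐ[volume] fun ξ => iPow s (2 * Real.pi * ξ) * realFourier ψ ξ := by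
    filter_upwards [Measure.ae_ne volume (0 : ℝ)] with ξ hξ
    rw [hψ.realFourier_iteratedDeriv, ← mul_assoc,
      one_div_cpow_mul_pow (s := s) (by ring) (mul_ne_zero Real.two_pi_pos.ne' hξ)]
  have hint : Integrable fun ξ => iPow s (2 * Real.pi * ξ) * realFourier ψ ξ :=
    memLp_one_iff_integrable.1 (hψ.memLp_mul_realFourier hs (measurable_iPow_two_pi s)
      (fun ξ => norm_iPow s _) 1)
  have hΓ : (Real.Gamma (((⌊s⌋₊ + 1 : ℕ) : ℝ) - s) : ℂ) ≠ 0 := by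
    exact_mod_cast (Real.Gamma_pos_of_pos hσ).ne'
  rw [leftRLDeriv_eq hψ x hσ, Complex.ofReal_mul,
    integral_powKernel_mul hσ (hψ.iteratedDeriv _) (hint.congr hsym.symm),
    ← integral_const_mul, fourierInv_eq_integral]
  refine integral_congr_ae ?_
  filter_upwards [hsym] with ξ hξ
  rw [hξ, Complex.ofReal_div, Complex.ofReal_one]
  field_simp

theorem rightRLIntegral_eq_left (σ : ℝ) (w : ℝ → ℝ) :
    rightRLIntegral σ w = fun x => leftRLIntegral σ (fun y => w (-y)) (-x) := by
  ext x
  rw [rightRLIntegral, leftRLIntegral]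
  congr 1
  rw [← integral_indicator measurableSet_Ioi, ← integral_indicator measurableSet_Iio,
    ← integral_neg_eq_self]
  refine integral_congr_ae (Eventually.of_forall fun t => ?_)
  by_cases h : t < -x
  · simp only
    rw [indicator_of_mem (show -t ∈ Ioi x by simp; linarith), indicator_of_mem (mem_Iio.2 h)]
    congr 2
    ring
  · simp only
    rw [indicator_of_notMem (show -t ∉ Ioi x by simp; linarith),
      indicator_of_notMem (by simpa using h)]

theorem rightRLDeriv_eq_left (s : ℝ) (w : ℝ → ℝ) (x : ℝ) :
    rightRLDeriv s w x = leftRLDeriv s (fun y => w (-y)) (-x) := by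
  rw [rightRLDeriv, rightRLIntegral_eq_left, iteratedDeriv_comp_neg, leftRLDeriv, smul_eq_mul,
    ← mul_assoc, ← mul_pow]
  simp

/-- The right Riemann–Liouville derivative of a test function has symbol `(-2πiξ)^s`. -/
theorem rightRLDeriv_eq_fourierInv {s : ℝ} (hs : 0 ≤ s) {ψ : ℝ → ℝ} (hψ : IsTestFunction ψ)
    (x : ℝ) : (rightRLDeriv s ψ x : ℂ) =
      𝓕⁻ (fun ξ => iPow s (-(2 * Real.pi * ξ)) * realFourier ψ ξ) x := by
  rw [rightRLDeriv_eq_left, leftRLDeriv_eq_fourierInv hs hψ.comp_neg, fourierInv_eq_integral,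
    fourierInv_eq_integral, ← integral_neg_eq_self]
  refine integral_congr_ae (Eventually.of_forall fun ξ => ?_)
  simp only
  rw [realFourier_comp_neg, neg_neg, neg_mul_neg, mul_neg]

/-! ### The Sobolev spaces -/

theorem isAdjointMultiplier_rightRLDeriv {s : ℝ} (hs : 0 ≤ s) :
    IsAdjointMultiplier s (fun ξ => iPow s (2 * Real.pi * ξ)) (rightRLDeriv s) where
  nonneg := hs
  measurable := measurable_iPow_two_pi s
  norm_eq _ := norm_iPow s _
  apply_eq ψ hψ x := by simp only [conj_iPow]; exact rightRLDeriv_eq_fourierInv hs hψ x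

theorem isAdjointMultiplier_leftRLDeriv {s : ℝ} (hs : 0 ≤ s) :
    IsAdjointMultiplier s (fun ξ => iPow s (-(2 * Real.pi * ξ))) (leftRLDeriv s) where
  nonneg := hs
  measurable := (measurable_iPow s).comp (by fun_prop)
  norm_eq _ := by rw [norm_iPow, abs_neg]
  apply_eq ψ hψ x := by
    simp only [conj_iPow, neg_neg]; exact leftRLDeriv_eq_fourierInv hs hψ x

theorem plancherel_weakLeftDeriv {s : ℝ} (hs : 0 ≤ s) (v : WL s) :
    plancherel (weakLeftDeriv v) =ᵐ[volume]
      fun ξ => iPow s (2 * Real.pi * ξ) * plancherel (v : L2) ξ :=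
  (isAdjointMultiplier_rightRLDeriv hs).plancherel_ae_eq fun ψ hψ =>
    ((weakLeftDeriv_spec v).2.2 ψ hψ).2

theorem plancherel_weakRightDeriv {s : ℝ} (hs : 0 ≤ s) (v : WR s) :
    plancherel (weakRightDeriv v) =ᵐ[volume]
      fun ξ => iPow s (-(2 * Real.pi * ξ)) * plancherel (v : L2) ξ :=
  (isAdjointMultiplier_leftRLDeriv hs).plancherel_ae_eq fun ψ hψ =>
    ((weakRightDeriv_spec v).2.2 ψ hψ).2

end FracSobolev

theorem mainTheorem1 (s : ℝ) (hs : 0 ≤ s) :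
    (FracSobolev.WL s = FracSobolev.HF s ∧ FracSobolev.WR s = FracSobolev.HF s) ∧
    (∀ (v : FracSobolev.L2) (hL : v ∈ FracSobolev.WL s) (hR : v ∈ FracSobolev.WR s)
      (hH : v ∈ FracSobolev.HF s),
      FracSobolev.normWL ⟨v, hL⟩ = FracSobolev.normHF ⟨v, hH⟩ ∧
      FracSobolev.normWR ⟨v, hR⟩ = FracSobolev.normHF ⟨v, hH⟩) ∧
    (∀ v : FracSobolev.WL s,
      FracSobolev.plancherel (FracSobolev.weakLeftDeriv v) =ᵐ[MeasureTheory.volume]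
        fun ξ : ℝ => FracSobolev.iPow s (2 * Real.pi * ξ) *
          FracSobolev.plancherel (v : FracSobolev.L2) ξ) ∧
    (∀ v : FracSobolev.WR s,
      FracSobolev.plancherel (FracSobolev.weakRightDeriv v) =ᵐ[MeasureTheory.volume]
        fun ξ : ℝ => FracSobolev.iPow s (-(2 * Real.pi * ξ)) *
          FracSobolev.plancherel (v : FracSobolev.L2) ξ) := by
  have hDL := FracSobolev.isAdjointMultiplier_rightRLDeriv hs
  have hDR := FracSobolev.isAdjointMultiplier_leftRLDeriv hs
  refine ⟨⟨?_, ?_⟩, fun v hL hR hH => ⟨?_, ?_⟩, FracSobolev.plancherel_weakLeftDeriv hs,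
    FracSobolev.plancherel_weakRightDeriv hs⟩
  · ext v
    exact (hDL.mem_HF_iff_exists v).symm
  · ext v
    exact (hDR.mem_HF_iff_exists v).symm
  · rw [FracSobolev.normWL, FracSobolev.normHF, FracSobolev.norm_eq_seminormHF hDL.norm_eq hH
      (FracSobolev.plancherel_weakLeftDeriv hs ⟨v, hL⟩)]
  · rw [FracSobolev.normWR, FracSobolev.normHF, FracSobolev.norm_eq_seminormHF hDR.norm_eq hH
      (FracSobolev.plancherel_weakRightDeriv hs ⟨v, hR⟩)]
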